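/- Let $(X,\Sigma,\mu)$ be a $\sigma$-finite measure space, let $\mathcal A\subseteq\Sigma$ be a sub-$\sigma$-algebra on which $\mu$ is $\sigma$-finite, and let $E=E^{\mathcal A}$ be the conditional expectation with respect to $\mathcal A$, defined (with values in $[0,\infty]$) on non-negative measurable functions and on $\mathcal D(E)$, the set of measurable functions $f:X\to\mathbb C$ with $E(|f|)<\infty$ a.e. Let $u,w\in\mathcal D(E)$ be such that $T=M_wEM_u$, $Tf=wE(uf)$, is an (everywhere defined) bounded operator on $L^2(\Sigma)$; let $M_{\bar u}EM_{\bar w}$ denote the operator $f\mapsto\bar uE(\bar wf)$, defined for those $f\in L^2(\Sigma)$ with $\bar wf\in\mathcal D(E)$ and $\bar uE(\bar wf)\in L^2(\Sigma)$. Let $n\ge 0$ and $k\ge 1$ be integers and let $S_0=\{x\in X: E(uw)(x)\ne0\}$. Suppose that for every real $t>0$, almost everywhere on $X$, $$|E(uw)|^{2(n+k)}E(|w|^2)-(1+n)t^n|E(uw)|^{2(k-1)}\chi_{S_0}\,(E(|w|^2))^2E(|u|^2)+n\,t^{n+1}|E(uw)|^{2(k-1)}\chi_{S_0}\,E(|w|^2)\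 \ge\ 0$$ (where every term is read as $0$ off $S_0$). Then: (a) For every $0\ne\lambda\in\mathbb C$, $\ker(T-\lambda)\subseteq\ker(T^*-\bar\lambda)$ and $\ker(T-\lambda)\subseteq\ker(M_{\bar u}EM_{\bar w}-\bar\lambda)$. (b) $\sigma_{jp}(T)\setminus\{0\}=\sigma_p(T)\setminus\{0\}$ and $\sigma_{ja}(T)\setminus\{0\}=\sigma_a(T)\setminus\{0\}$. Here $\lambda\in\sigma_p(T)$ if $(T-\lambda)x=0$ for some $x\ne0$, and $\lambda\in\sigma_{jp}(T)$ if moreover $(T^*-\bar\lambda)x=0$ for the same $x$; $\lambda\in\sigma_a(T)$ if $(T-\lambda)x_j\to0$ for some sequence of unit vectors $x_j$, and $\lambda\in\sigma_{ja}(T)$ if moreover $(T^*-\bar\lambda)x_j\to0$ for the same sequence. (c) If $\lambda\neq\lambda'$ are complex numbers, then $\ker(T-\lambda)\perp\ker(T-\lambda')$. (d) $\ker(T-\lambda)=\ker(T-\lambda)^2$ for every $0\neq\lambda\in\mathbb C$, and $\ker T^{k+1}=\ker T^{k+2}$. (e) $T$ has the single valued extension property: for every $\lambda_0\in\mathbb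 C$ and every open neighbourhood $U$ of $\lambda_0$, the only analytic function $f:U\to L^2(\Sigma)$ with $(\lambda-T)f(\lambda)=0$ for all $\lambda\in U$ is $f\equiv0$. -/

import Mathlib

open MeasureTheory Filter Topology
open scoped ENNReal ComplexConjugate

noncomputable section

namespace WeightedCE

section ConditionalExpectation

variable {X : Type*} {mX : MeasurableSpace X}

/-- Membership in the domain `D(E)` of the conditional expectation with respect to `A`:
`f` is measurable and `E(|f|)` is finite almost everywhere. -/
def Conditionable (A : MeasurableSpace X) (μ : Measure[mX] X) (f : X → ℂ) : Prop :=
  AEMeasurable f μ ∧ ∀ᵐ x ∂μ, condLExp A μ (fun y => ‖f y‖ₑ) x < ∞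

/-- The conditional expectation `E(f)` of a conditionable complex function `f` (which need not be
integrable), obtained by linearity from the conditional expectations (Radon-Nikodym derivatives)
of the positive and negative parts of its real and imaginary parts. -/
def condE (A : MeasurableSpace X) (μ : Measure[mX] X) (f : X → ℂ) (x : X) : ℂ :=
  ⟨(condLExp A μ (fun y => ENNReal.ofReal (f y).re) x).toReal
      - (condLExp A μ (fun y => ENNReal.ofReal (-(f y).re)) x).toReal,
   (condLExp A μ (fun y => ENNReal.ofReal (f y).im) x).toReal
      - (condLExp A μ (fun y => ENNReal.ofReal (-(f y).im)) x).toReal⟩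

/-- `E(|f|²)`, as a real function (with value `0` at the points where it is infinite). -/
def condSq (A : MeasurableSpace X) (μ : Measure[mX] X) (f : X → ℂ) (x : X) : ℝ :=
  (condLExp A μ (fun y => ‖f y‖ₑ ^ 2) x).toReal

/-- The graph of the operator `M_w E M_u` in `L²(μ)`: the function `f` lies in its domain
(that is, `u f` is conditionable and `w E(u f)` is in `L²`), and `g = w E(u f)`. -/
def IsWCE (A : MeasurableSpace X) (μ : Measure[mX] X) (w u : X → ℂ) (f g : Lp ℂ 2 μ) : Prop :=
  Conditionable A μ (fun x => u x * f x) ∧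
    g =ᵐ[μ] fun x => w x * condE A μ (fun y => u y * f y) x

open Classical in
/-- The function `α_t`, with `χ` the indicator function of the support of `E(uw)`:
`|E(uw)|^{2(n+k)} E(|w|²) - (1+n) t^n |E(uw)|^{2(k-1)} χ E(|w|²)² E(|u|²)
+ n t^{n+1} |E(uw)|^{2(k-1)} χ E(|w|²)`. It is used for `k ≥ 1` only. -/
def alpha (A : MeasurableSpace X) (μ : Measure[mX] X) (w u : X → ℂ) (n k : ℕ) (t : ℝ) (x : X) : ℝ :=
  let e : ℝ := ‖condE A μ (fun y => u y * w y) x‖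
  let χ : ℝ := if condE A μ (fun y => u y * w y) x = 0 then 0 else 1
  e ^ (2 * (n + k)) * condSq A μ w x
    - (1 + n) * t ^ n * e ^ (2 * (k - 1)) * χ * condSq A μ w x ^ 2 * condSq A μ u x
    + n * t ^ (n + 1) * e ^ (2 * (k - 1)) * χ * condSq A μ w x

end ConditionalExpectation

section Operators

variable {H : Type*} [NormedAddCommGroup H] [InnerProductSpace ℂ H] [CompleteSpace H]

/-- The operator `T - z I`. -/
def shift (T : H →L[ℂ] H) (z : ℂ) : H →L[ℂ] H := T - z • ContinuousLinearMap.id ℂ H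

/-- The kernel of a bounded operator. -/
def kernel (T : H →L[ℂ] H) : Submodule ℂ H := LinearMap.ker (T : H →ₗ[ℂ] H)

/-- The point spectrum. -/
def pointSpectrum (T : H →L[ℂ] H) : Set ℂ :=
  {z | ∃ x : H, x ≠ 0 ∧ shift T z x = 0}

/-- The joint point spectrum. -/
def jointPointSpectrum (T : H →L[ℂ] H) : Set ℂ :=
  {z | ∃ x : H, x ≠ 0 ∧ shift T z x = 0 ∧ shift (ContinuousLinearMap.adjoint T) (conj z) x = 0}

/-- The approximate point spectrum. -/
def approxPointSpectrum (T : H →L[ℂ] H) : Set ℂ :=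
  {z | ∃ x : ℕ → H, (∀ j, ‖x j‖ = 1) ∧ Tendsto (fun j => shift T z (x j)) atTop (𝓝 0)}

/-- The joint approximate point spectrum. -/
def jointApproxPointSpectrum (T : H →L[ℂ] H) : Set ℂ :=
  {z | ∃ x : ℕ → H, (∀ j, ‖x j‖ = 1) ∧ Tendsto (fun j => shift T z (x j)) atTop (𝓝 0) ∧
    Tendsto (fun j => shift (ContinuousLinearMap.adjoint T) (conj z) (x j)) atTop (𝓝 0)}

/-- The single valued extension property at `z₀`. -/
def HasSVEPAt (T : H →L[ℂ] H) (z₀ : ℂ) : Prop :=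
  ∀ U : Set ℂ, IsOpen U → z₀ ∈ U → ∀ f : ℂ → H, AnalyticOnNhd ℂ f U →
    (∀ z ∈ U, shift T z (f z) = 0) → ∀ z ∈ U, f z = 0

/-- The single valued extension property (at every point of the plane). -/
def HasSVEP (T : H →L[ℂ] H) : Prop := ∀ z₀ : ℂ, HasSVEPAt T z₀

end Operators

end WeightedCE

end

/-! Write J = E(|w|²), K = E(|u|²), e = E(uw), S₀ = {e ≠ 0}. The theorem holds because the
hypothesis forces equality in the conditional Cauchy-Schwarz inequality on S₀, which makes T the
orthogonal sum of a normal operator and an operator of square zero.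

Boundedness of T gives JK ≤ ‖T‖² a.e. (`condLExp_mul_condLExp_le`), so J and K are positive and
finite on S₀. Taking t = JK pointwise in the hypothesis turns it into |e|^{2(k-1)} J (|e|^{2(n+1)} -
(JK)^{n+1}) ≥ 0, that is, JK ≤ |e|² on S₀. Cauchy-Schwarz being the reverse inequality, u = c w̄ on
S₀ with c measurable for the sub-σ-algebra (`exists_eq_mul_conj`).

Let P be multiplication by the indicator of S₀; it commutes with T. With v = χ_{S₀} w one has TP =
M_c M_v E M_v̄, whose adjoint has c̄ in place of c; hence TP is normal. Since T² = M_e T vanishes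
off S₀, T(1 - P) has square zero. All spectral claims follow from this decomposition
(`IsNormalPlusNilpotent`): for z ≠ 0 the square-zero summand contributes no eigenvectors, exact or
approximate, and on the normal part T - z and its adjoint have equal norms. -/

namespace WeightedCE

/-! ### Conditional expectation of functions with values in [0, ∞] -/

section CondLExp

variable {X : Type*} {A mX : MeasurableSpace X} {μ : Measure X}

/-- Pull-out property of the conditional Lebesgue expectation, integrated form. -/
lemma lintegral_mul_condLExp (hA : A ≤ mX) [SigmaFinite (μ.trim hA)] {a g : X → ℝ≥0∞}
    (ha : Measurable[A] a) (hg : AEMeasurable g μ) :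
    ∫⁻ x, condLExp A μ g x * a x ∂μ = ∫⁻ x, g x * a x ∂μ := by
  have ha' : Measurable[mX] a := ha.mono hA le_rfl
  -- The densities g and E(g) define measures that agree on the sub-σ-algebra, and the integral of a
  -- only sees these restrictions. No finiteness is needed.
  have key : (μ.withDensity (condLExp A μ g)).trim hA = (μ.withDensity g).trim hA := by
    refine @Measure.ext _ A _ _ fun s hs => ?_
    rw [trim_measurableSet_eq hA hs, trim_measurableSet_eq hA hs, withDensity_apply _ (hA s hs),
      withDensity_apply _ (hA s hs), setLIntegral_condLExp hA _ _ hs]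
  have h1 := lintegral_withDensity_eq_lintegral_mul₀ (μ := μ)
    (measurable_condLExp' A μ g).aemeasurable ha'.aemeasurable
  have h2 := lintegral_withDensity_eq_lintegral_mul₀ hg ha'.aemeasurable
  simp only [Pi.mul_apply] at h1 h2
  rw [← h1, ← h2, ← lintegral_trim hA ha, ← lintegral_trim hA ha, key]

/-- Pull-out property of the conditional Lebesgue expectation. -/
lemma condLExp_mul (hA : A ≤ mX) [SigmaFinite (μ.trim hA)] {a g : X → ℝ≥0∞}
    (ha : Measurable[A] a) (hg : AEMeasurable g μ) :
    condLExp A μ (fun x => g x * a x) =ᵐ[μ] fun x => condLExp A μ g x * a x := by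
  refine (ae_eq_condLExp hA μ _ ((measurable_condLExp A μ g).mul ha) fun s hs => ?_).symm
  have h := lintegral_mul_condLExp hA (ha.indicator hs) hg
  rw [← lintegral_indicator (hA s hs), ← lintegral_indicator (hA s hs)]
  convert h using 3 with x x
  all_goals by_cases hx : x ∈ s <;> simp [hx]

/-- Conditional monotone convergence. -/
lemma condLExp_iSup (hA : A ≤ mX) [SigmaFinite (μ.trim hA)] {g : ℕ → X → ℝ≥0∞}
    (hg : ∀ m, AEMeasurable (g m) μ) (hmono : ∀ x, Monotone fun m => g m x) :
    condLExp A μ (fun x => ⨆ m, g m x) =ᵐ[μ] fun x => ⨆ m, condLExp A μ (g m) x := by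
  have hm : ∀ᵐ x ∂μ, Monotone fun m => condLExp A μ (g m) x := by
    have : ∀ᵐ x ∂μ, ∀ m, condLExp A μ (g m) x ≤ condLExp A μ (g (m + 1)) x :=
      ae_all_iff.2 fun m => condLExp_mono (ae_of_all _ fun x => hmono x (Nat.le_succ m))
    filter_upwards [this] with x hx using monotone_nat_of_le_succ hx
  refine (ae_eq_condLExp hA μ _ (Measurable.iSup fun m => measurable_condLExp A μ (g m))
    fun s hs => ?_).symm
  rw [lintegral_iSup' (fun m => (measurable_condLExp' A μ (g m)).aemeasurable)
      (ae_restrict_of_ae hm),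
    lintegral_iSup' (fun m => (hg m).restrict) (ae_of_all _ hmono)]
  exact iSup_congr fun m => setLIntegral_condLExp hA μ (g m) hs

lemma condLExp_indicator (hA : A ≤ mX) [SigmaFinite (μ.trim hA)] {g : X → ℝ≥0∞} {s : Set X}
    (hs : MeasurableSet[A] s) (hg : AEMeasurable g μ) :
    condLExp A μ (s.indicator g) =ᵐ[μ] s.indicator (condLExp A μ g) := by
  have h := condLExp_mul hA (μ := μ) (a := s.indicator 1)
    (Measurable.indicator (@measurable_const _ _ _ A 1) hs) hg
  have h1 (k : X → ℝ≥0∞) : (fun x => k x * s.indicator 1 x) = s.indicator k :=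
    funext fun x => by by_cases hx : x ∈ s <;> simp [hx]
  rwa [h1, h1] at h

/-- The set where E(g) vanishes belongs to the sub-σ-algebra, so g has integral zero over it. -/
lemma ae_eq_zero_of_condLExp_eq_zero (hA : A ≤ mX) [SigmaFinite (μ.trim hA)] {g : X → ℝ≥0∞}
    (hg : AEMeasurable g μ) : ∀ᵐ x ∂μ, condLExp A μ g x = 0 → g x = 0 := by
  have hs : MeasurableSet[A] {x | condLExp A μ g x = 0} :=
    measurable_condLExp A μ g (measurableSet_singleton 0)
  have h := setLIntegral_condLExp hA μ g hs
  rw [setLIntegral_congr_fun (g := fun _ => 0) (hA _ hs) (fun x hx => hx), lintegral_zero, eq_comm,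
    lintegral_eq_zero_iff' hg.restrict] at h
  exact (ae_restrict_iff' (hA _ hs)).1 h

/-- A function with finite conditional expectation is integrable over countably many measurable
sets of the sub-σ-algebra which cover the space. -/
lemma exists_cover_lintegral_lt_top (hA : A ≤ mX) [SigmaFinite (μ.trim hA)] {g : X → ℝ≥0∞}
    (hfin : ∀ᵐ x ∂μ, condLExp A μ g x < ∞) :
    ∃ B : ℕ → Set X, (∀ n, MeasurableSet[A] (B n)) ∧ (∀ n, ∫⁻ x in B n, g x ∂μ < ∞) ∧
      ∀ᵐ x ∂μ, ∃ n, x ∈ B n := by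
  let S := @spanningSets X A (μ.trim hA) _
  have hS : ∀ n, MeasurableSet[A] (S n) := fun n => @measurableSet_spanningSets X A (μ.trim hA) _ n
  have hSfin : ∀ n, μ (S n) < ∞ := fun n => by
    rw [← trim_measurableSet_eq hA (hS n)]
    exact @measure_spanningSets_lt_top X A (μ.trim hA) _ n
  have hle : ∀ n : ℕ, MeasurableSet[A] {x | condLExp A μ g x ≤ n} := fun n =>
    measurable_condLExp A μ g measurableSet_Iic
  -- On such a piece the integral of g equals that of E(g), which is at most n times a finite
  -- measure.
  refine ⟨fun n => S n ∩ {x | condLExp A μ g x ≤ n}, fun n => (hS n).inter (hle n), fun n => ?_, ?_⟩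
  · rw [← setLIntegral_condLExp hA μ g ((hS n).inter (hle n))]
    calc ∫⁻ x in S n ∩ {x | condLExp A μ g x ≤ n}, condLExp A μ g x ∂μ
        ≤ ∫⁻ x in S n ∩ {x | condLExp A μ g x ≤ n}, (n : ℝ≥0∞) ∂μ :=
          setLIntegral_mono' (hA _ ((hS n).inter (hle n))) fun x hx => hx.2
      _ = n * μ (S n ∩ {x | condLExp A μ g x ≤ n}) := setLIntegral_const _ _
      _ < ∞ := ENNReal.mul_lt_top (by simp)
          ((measure_mono Set.inter_subset_left).trans_lt (hSfin n))
  · filter_upwards [hfin] with x hx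
    obtain ⟨p, hp⟩ := ENNReal.exists_nat_gt hx.ne
    have hxS : x ∈ ⋃ n, S n := by
      rw [show ⋃ n, S n = Set.univ from @iUnion_spanningSets X A (μ.trim hA) _]; trivial
    obtain ⟨q, hq⟩ := Set.mem_iUnion.1 hxS
    have hmono : S q ⊆ S (max p q) :=
      @monotone_spanningSets X A (μ.trim hA) _ _ _ (le_max_right p q)
    refine ⟨max p q, hmono hq, ?_⟩
    exact hp.le.trans (by exact_mod_cast le_max_left p q)

end CondLExp

/-! ### Conditional expectation of complex functions that need not be integrable -/

section CondE

variable {X : Type*} {A mX : MeasurableSpace X} {μ : Measure X} {f g : X → ℂ}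

lemma Conditionable.mono {h : X → ℝ≥0∞} (hf : AEMeasurable f μ) (hfh : ∀ᵐ x ∂μ, ‖f x‖ₑ ≤ h x)
    (hh : ∀ᵐ x ∂μ, condLExp A μ h x < ∞) : Conditionable A μ f := by
  refine ⟨hf, ?_⟩
  filter_upwards [condLExp_mono (mΩ := A) hfh, hh] with x h1 h2 using h1.trans_lt h2

lemma Conditionable.congr (hf : Conditionable A μ f) (h : f =ᵐ[μ] g) : Conditionable A μ g :=
  Conditionable.mono (hf.1.congr h) (by filter_upwards [h] with x hx; rw [hx]) hf.2

lemma Conditionable.add (hf : Conditionable A μ f) (hg : Conditionable A μ g) :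
    Conditionable A μ (fun x => f x + g x) := by
  refine Conditionable.mono (h := (fun x => ‖f x‖ₑ) + fun x => ‖g x‖ₑ) (hf.1.add hg.1)
    (ae_of_all _ fun x => enorm_add_le _ _) ?_
  filter_upwards [condLExp_add_left (mΩ := A) (fun x => ‖g x‖ₑ) hf.1.enorm, hf.2, hg.2]
    with x h h1 h2
  rw [h]
  exact ENNReal.add_lt_top.2 ⟨h1, h2⟩

lemma Conditionable.mul (hA : A ≤ mX) [SigmaFinite (μ.trim hA)] {a : X → ℂ}
    (ha : Measurable[A] a) (hf : Conditionable A μ f) :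
    Conditionable A μ (fun x => a x * f x) := by
  refine Conditionable.mono (h := fun x => ‖f x‖ₑ * ‖a x‖ₑ)
    ((ha.mono hA le_rfl).aemeasurable.mul hf.1)
    (ae_of_all _ fun x => by simp [mul_comm]) ?_
  filter_upwards [condLExp_mul hA (show Measurable[A] fun x => ‖a x‖ₑ from
    measurable_enorm.comp ha) hf.1.enorm, hf.2] with x h h1
  rw [h]
  exact ENNReal.mul_lt_top h1 (by simp)

lemma Conditionable.conj (hf : Conditionable A μ f) : Conditionable A μ (fun x => conj (f x)) :=
  Conditionable.mono (RCLike.continuous_conj.measurable.comp_aemeasurable hf.1)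
    (ae_of_all _ fun x => by simp) hf.2

/-- The product of two functions with finite conditional second moments is conditionable. -/
lemma Conditionable.mul_of_sq (hf : AEMeasurable f μ) (hg : AEMeasurable g μ)
    (hf2 : ∀ᵐ x ∂μ, condLExp A μ (fun y => ‖f y‖ₑ ^ 2) x < ∞)
    (hg2 : ∀ᵐ x ∂μ, condLExp A μ (fun y => ‖g y‖ₑ ^ 2) x < ∞) :
    Conditionable A μ (fun x => f x * g x) := by
  refine Conditionable.mono (h := (fun x => ‖f x‖ₑ ^ 2) + fun x => ‖g x‖ₑ ^ 2) (hf.mul hg)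
    (ae_of_all _ fun x => ?_) ?_
  · simp only [enorm_mul, Pi.add_apply]
    rcases le_total ‖f x‖ₑ ‖g x‖ₑ with h | h
    · exact (mul_le_mul_left h _).trans (by rw [← sq]; exact le_add_self)
    · exact (mul_le_mul_right h _).trans (by rw [← sq]; exact le_self_add)
  · filter_upwards [condLExp_add_left (mΩ := A) (fun x => ‖g x‖ₑ ^ 2) (hf.enorm.pow_const 2),
      hf2, hg2] with x h h1 h2
    rw [h]
    exact ENNReal.add_lt_top.2 ⟨h1, h2⟩

lemma condLExp_sq_lt_top_of_memLp (hA : A ≤ mX) [SigmaFinite (μ.trim hA)] (hf : MemLp f 2 μ) :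
    ∀ᵐ x ∂μ, condLExp A μ (fun y => ‖f y‖ₑ ^ 2) x < ∞ := by
  refine condLExp_lt_top ?_
  have := (eLpNorm_lt_top_iff_lintegral_rpow_enorm_lt_top two_ne_zero ENNReal.ofNat_ne_top).1 hf.2
  simpa using this.ne

lemma measurable_condE (A : MeasurableSpace X) (μ : Measure[mX] X) (f : X → ℂ) :
    Measurable[A] (condE A μ f) := by
  have h (h : X → ℝ≥0∞) : Measurable[A] fun x => (condLExp A μ h x).toReal :=
    (measurable_condLExp A μ h).ennreal_toReal
  exact Complex.measurableEquivRealProd.symm.measurable.comp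
    (((h _).sub (h _)).prodMk ((h _).sub (h _)))

lemma measurable_condSq (A : MeasurableSpace X) (μ : Measure[mX] X) (f : X → ℂ) :
    Measurable[A] (condSq A μ f) :=
  (measurable_condLExp A μ _).ennreal_toReal

lemma condE_congr (h : f =ᵐ[μ] g) : condE A μ f =ᵐ[μ] condE A μ g := by
  have key (F : ℂ → ℝ≥0∞) : condLExp A μ (fun x => F (f x)) =ᵐ[μ] condLExp A μ (fun x => F (g x)) :=
    condLExp_congr_ae (h.fun_comp F)
  filter_upwards [key fun z => ENNReal.ofReal z.re, key fun z => ENNReal.ofReal (-z.re),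
    key fun z => ENNReal.ofReal z.im, key fun z => ENNReal.ofReal (-z.im)] with x h1 h2 h3 h4
  simp only [condE, h1, h2, h3, h4]

lemma condE_conj (A : MeasurableSpace X) (μ : Measure[mX] X) (f : X → ℂ) (x : X) :
    condE A μ (fun y => conj (f y)) x = conj (condE A μ f x) := by
  apply Complex.ext <;> simp [condE]

lemma condE_ofReal (hA : A ≤ mX) [SigmaFinite (μ.trim hA)] {h : X → ℝ} (hh : ∀ x, 0 ≤ h x) (x : X) :
    condE A μ (fun y => (h y : ℂ)) x =
      ((condLExp A μ (fun y => ENNReal.ofReal (h y)) x).toReal : ℂ) := by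
  have h0 : (fun y => ENNReal.ofReal (-h y)) = 0 := by
    ext y; simp [hh y]
  have h1 : (fun _ => 0 : X → ℝ≥0∞) = 0 := rfl
  apply Complex.ext <;> simp [condE, h0, h1]

lemma condE_norm_sq (hA : A ≤ mX) [SigmaFinite (μ.trim hA)] (f : X → ℂ) (x : X) :
    condE A μ (fun y => ((‖f y‖ ^ 2 : ℝ) : ℂ)) x = (condSq A μ f x : ℂ) := by
  rw [condE_ofReal hA (fun y => by positivity), condSq]
  simp only [ENNReal.ofReal_pow (norm_nonneg _), ofReal_norm]

lemma condE_indicator (hA : A ≤ mX) [SigmaFinite (μ.trim hA)] {s : Set X} (hs : MeasurableSet[A] s)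
    (hf : AEMeasurable f μ) :
    condE A μ (s.indicator f) =ᵐ[μ] s.indicator (condE A μ f) := by
  have key (F : ℂ → ℝ≥0∞) (hF : Measurable F) (h0 : F 0 = 0) :
      condLExp A μ (fun x => F (s.indicator f x)) =ᵐ[μ]
        s.indicator (condLExp A μ (fun x => F (f x))) := by
    rw [show (fun x => F (s.indicator f x)) = s.indicator fun x => F (f x) from
      funext fun x => by by_cases hx : x ∈ s <;> simp [hx, h0]]
    exact condLExp_indicator hA hs (hF.comp_aemeasurable hf)
  filter_upwards [key (fun z => ENNReal.ofReal z.re) (by fun_prop) (by simp),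
    key (fun z => ENNReal.ofReal (-z.re)) (by fun_prop) (by simp),
    key (fun z => ENNReal.ofReal z.im) (by fun_prop) (by simp),
    key (fun z => ENNReal.ofReal (-z.im)) (by fun_prop) (by simp)] with x h1 h2 h3 h4
  simp only [condE, h1, h2, h3, h4]
  by_cases hx : x ∈ s <;> simp [hx, Complex.ext_iff, condE]

/-- On integrable functions, `condE` is the conditional expectation of Mathlib. -/
lemma condE_ae_eq_condExp (hf : Integrable f μ) : condE A μ f =ᵐ[μ] condExp A μ f := by
  have key (h : X → ℝ) (hh : Integrable h μ) :
      (fun x => (condLExp A μ (fun y => ENNReal.ofReal (h y)) x).toReal -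
        (condLExp A μ (fun y => ENNReal.ofReal (-h y)) x).toReal) =ᵐ[μ] condExp A μ h := by
    have hne (h : X → ℝ) (hh : Integrable h μ) : ∫⁻ x, ENNReal.ofReal (h x) ∂μ ≠ ∞ :=
      hh.lintegral_lt_top.ne
    have h1 := toReal_condLExp A (μ := μ) hh.aemeasurable.ennreal_ofReal (hne h hh)
    have h2 := toReal_condLExp A (μ := μ) hh.neg.aemeasurable.ennreal_ofReal (hne _ hh.neg)
    have hint (h : X → ℝ) (hh : Integrable h μ) :
        Integrable (fun x => (ENNReal.ofReal (h x)).toReal) μ :=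
      integrable_toReal_of_lintegral_ne_top hh.aemeasurable.ennreal_ofReal (hne h hh)
    have h3 := condExp_sub (hint h hh) (hint _ hh.neg) A
    have h4 : (fun x => (ENNReal.ofReal (h x)).toReal) - (fun x => (ENNReal.ofReal ((-h) x)).toReal)
        = h := by
      ext x
      simp only [Pi.sub_apply, Pi.neg_apply, ENNReal.toReal_ofReal']
      exact max_zero_sub_max_neg_zero_eq_self _
    rw [h4] at h3
    filter_upwards [h1, h2, h3] with x h1 h2 h3
    rw [h3, Pi.sub_apply, ← h1, ← h2]
    rfl
  filter_upwards [key _ hf.re, key _ hf.im, Complex.reCLM.comp_condExp_comm (m := A) hf,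
    Complex.imCLM.comp_condExp_comm (m := A) hf] with x h1 h2 h3 h4
  apply Complex.ext
  · exact h1.trans h3.symm
  · exact h2.trans h4.symm

/-- Localization: identities known for integrable functions transfer to conditionable ones, piece by
piece over a countable cover on which they are integrable. -/
lemma condE_ae_eq_condExp_indicator (hA : A ≤ mX) [SigmaFinite (μ.trim hA)] {s : Set X}
    (hs : MeasurableSet[A] s) (hf : AEMeasurable f μ) (hfs : IntegrableOn f s μ) :
    ∀ᵐ x ∂μ, x ∈ s → condE A μ f x = condExp A μ (s.indicator f) x := by
  filter_upwards [condE_indicator hA hs hf,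
    condE_ae_eq_condExp (A := A) ((integrable_indicator_iff (hA s hs)).2 hfs)] with x h1 h2 hx
  rw [← h2, h1, Set.indicator_of_mem hx]

/-- Two conditionable functions are integrable over the sets of a countable cover. -/
lemma exists_cover_integrableOn (hA : A ≤ mX) [SigmaFinite (μ.trim hA)]
    (hf : Conditionable A μ f) (hg : Conditionable A μ g) :
    ∃ B : ℕ → Set X, (∀ n, MeasurableSet[A] (B n)) ∧ (∀ n, IntegrableOn f (B n) μ) ∧
      (∀ n, IntegrableOn g (B n) μ) ∧ ∀ᵐ x ∂μ, ∃ n, x ∈ B n := by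
  have hlt : ∀ᵐ x ∂μ, condLExp A μ ((fun x => ‖f x‖ₑ) + fun x => ‖g x‖ₑ) x < ∞ := by
    filter_upwards [condLExp_add_left (mΩ := A) (fun x => ‖g x‖ₑ) hf.1.enorm, hf.2, hg.2]
      with x h h1 h2
    rw [h]
    exact ENNReal.add_lt_top.2 ⟨h1, h2⟩
  obtain ⟨B, hB, hBfin, hcov⟩ := exists_cover_lintegral_lt_top hA hlt
  refine ⟨B, hB, fun n => ⟨hf.1.restrict.aestronglyMeasurable, ?_⟩,
    fun n => ⟨hg.1.restrict.aestronglyMeasurable, ?_⟩, hcov⟩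
  · exact (lintegral_mono fun x => le_self_add).trans_lt (hBfin n)
  · exact (lintegral_mono fun x => le_add_self).trans_lt (hBfin n)

lemma condE_add (hA : A ≤ mX) [SigmaFinite (μ.trim hA)]
    (hf : Conditionable A μ f) (hg : Conditionable A μ g) :
    condE A μ (fun x => f x + g x) =ᵐ[μ] fun x => condE A μ f x + condE A μ g x := by
  obtain ⟨B, hB, hfB, hgB, hcov⟩ := exists_cover_integrableOn hA hf hg
  have key : ∀ᵐ x ∂μ, ∀ n, x ∈ B n →
      condE A μ (fun x => f x + g x) x = condE A μ f x + condE A μ g x := by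
    refine ae_all_iff.2 fun n => ?_
    have h := condExp_add ((integrable_indicator_iff (hA _ (hB n))).2 (hfB n))
      ((integrable_indicator_iff (hA _ (hB n))).2 (hgB n)) A
    rw [← Set.indicator_add'] at h
    filter_upwards [h, condE_ae_eq_condExp_indicator hA (hB n) hf.1 (hfB n),
      condE_ae_eq_condExp_indicator hA (hB n) hg.1 (hgB n),
      condE_ae_eq_condExp_indicator hA (hB n) (hf.1.add hg.1) ((hfB n).add (hgB n))]
      with x h h1 h2 h3 hx
    rw [h1 hx, h2 hx, ← Pi.add_apply (condExp _ _ _), ← h]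
    exact h3 hx
  filter_upwards [key, hcov] with x h ⟨n, hn⟩ using h n hn

/-- Pull-out property of `condE`. -/
lemma condE_mul (hA : A ≤ mX) [SigmaFinite (μ.trim hA)] {a : X → ℂ}
    (ha : Measurable[A] a) (hf : Conditionable A μ f) :
    condE A μ (fun x => a x * f x) =ᵐ[μ] fun x => a x * condE A μ f x := by
  obtain ⟨B, hB, hfB, haB, hcov⟩ := exists_cover_integrableOn hA hf (hf.mul hA ha)
  have key : ∀ᵐ x ∂μ, ∀ n, x ∈ B n →
      condE A μ (fun x => a x * f x) x = a x * condE A μ f x := by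
    refine ae_all_iff.2 fun n => ?_
    have hi : ∀ x, (B n).indicator (fun x => a x * f x) x = a x * (B n).indicator f x := fun x => by
      by_cases hx : x ∈ B n <;> simp [hx]
    have hint := (integrable_indicator_iff (hA _ (hB n))).2 (haB n)
    have h := condExp_bilin_of_stronglyMeasurable_left (m := A) (μ := μ)
      (ContinuousLinearMap.mul ℝ ℂ) (f := a) (g := (B n).indicator f) ha.stronglyMeasurable
      (by simpa only [ContinuousLinearMap.mul_apply', ← hi] using hint)
      ((integrable_indicator_iff (hA _ (hB n))).2 (hfB n))
    simp only [ContinuousLinearMap.mul_apply', ← hi] at h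
    filter_upwards [h, condE_ae_eq_condExp_indicator hA (hB n) hf.1 (hfB n),
      condE_ae_eq_condExp_indicator hA (hB n) (hf.mul hA ha).1 (haB n)] with x h h1 h2 hx
    rw [h1 hx, ← h]
    exact h2 hx
  filter_upwards [key, hcov] with x h ⟨n, hn⟩ using h n hn

lemma integral_condE (hA : A ≤ mX) [SigmaFinite (μ.trim hA)] (hf : Integrable f μ) :
    ∫ x, condE A μ f x ∂μ = ∫ x, f x ∂μ := by
  rw [integral_congr_ae (condE_ae_eq_condExp hf), integral_condExp hA]

end CondE

/-! ### Boundedness of E(|w|²)E(|u|²) and equality in the conditional Cauchy-Schwarz inequality -/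

section Structure

variable {X : Type*} {A mX : MeasurableSpace X} {μ : Measure X} {u w : X → ℂ}

lemma enorm_sq_eq_lintegral (f : Lp ℂ 2 μ) : ‖f‖ₑ ^ 2 = ∫⁻ x, ‖f x‖ₑ ^ 2 ∂μ := by
  rw [Lp.enorm_def, eLpNorm_eq_lintegral_rpow_enorm_toReal two_ne_zero ENNReal.ofNat_ne_top,
    ← ENNReal.rpow_natCast, ← ENNReal.rpow_mul]
  simp

lemma enorm_ofReal_norm_sq (z : ℂ) : ‖((‖z‖ ^ 2 : ℝ) : ℂ)‖ₑ = ‖z‖ₑ ^ 2 := by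
  rw [← ofReal_norm, Complex.norm_real, norm_pow, norm_norm, ENNReal.ofReal_pow (norm_nonneg _),
    ofReal_norm]

open Classical in
/-- Truncation of complex numbers of modulus larger than `m`. -/
noncomputable def truncate (m : ℕ) (z : ℂ) : ℂ := if ‖z‖ ≤ m then z else 0

lemma measurable_truncate (m : ℕ) : Measurable (truncate m) :=
  Measurable.ite (measurableSet_le measurable_norm measurable_const) measurable_id measurable_const

lemma norm_truncate_le (m : ℕ) (z : ℂ) : ‖truncate m z‖ ≤ m := by
  unfold truncate; split_ifs with h <;> simp [h]

/-- This is why large values are replaced by 0 and not rescaled: the product of u with the conjugate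
of its truncation is an exact square, so its conditional expectation is a second moment. -/
lemma mul_conj_truncate (m : ℕ) (z : ℂ) :
    z * conj (truncate m z) = ((‖truncate m z‖ ^ 2 : ℝ) : ℂ) := by
  unfold truncate
  split_ifs with h <;> simp [Complex.mul_conj']

lemma monotone_enorm_truncate_sq (z : ℂ) : Monotone fun m => ‖truncate m z‖ₑ ^ 2 := by
  intro m p hmp
  have hmp' : (m : ℝ) ≤ p := by exact_mod_cast hmp
  simp only [truncate]
  split_ifs with h1 h2
  · exact le_rfl
  · exact absurd (h1.trans hmp') h2
  · simp
  · exact le_rfl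

lemma iSup_enorm_truncate_sq (z : ℂ) : ⨆ m, ‖truncate m z‖ₑ ^ 2 = ‖z‖ₑ ^ 2 := by
  apply le_antisymm
  · refine iSup_le fun m => ?_
    unfold truncate
    split_ifs <;> simp
  · obtain ⟨m, hm⟩ := exists_nat_ge ‖z‖
    refine le_iSup_of_le m ?_
    simp [truncate, hm]

/-- The test function `1_s ū_m` shows that `E(|w|²) E(|u_m|²) ≤ ‖T‖²` for the truncations `u_m`
of `u`. -/
lemma condLExp_mul_condLExp_truncate_le (hA : A ≤ mX) [SigmaFinite (μ.trim hA)]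
    (hu : Conditionable A μ u) (hw : Conditionable A μ w) (T : Lp ℂ 2 μ →L[ℂ] Lp ℂ 2 μ)
    (hT : ∀ f : Lp ℂ 2 μ, IsWCE A μ w u f (T f)) (m : ℕ) :
    ∀ᵐ x ∂μ, condLExp A μ (fun y => ‖w y‖ₑ ^ 2) x *
      condLExp A μ (fun y => ‖truncate m (u y)‖ₑ ^ 2) x ≤ ‖T‖ₑ ^ 2 := by
  set J := condLExp A μ (fun y => ‖w y‖ₑ ^ 2) with hJ
  set K := condLExp A μ (fun y => ‖truncate m (u y)‖ₑ ^ 2) with hK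
  have hJm : Measurable[A] J := measurable_condLExp _ _ _
  have hKm : Measurable[A] K := measurable_condLExp _ _ _
  have hJK : Measurable[A] fun x => J x * K x ^ 2 := hJm.mul (hKm.pow_const 2)
  have hum : AEMeasurable (fun y => truncate m (u y)) μ :=
    (measurable_truncate m).comp_aemeasurable hu.1
  have hKfin : ∀ᵐ x ∂μ, K x < ∞ := by
    have h := condLExp_mono (mΩ := A) (P := μ) (X := fun y => ‖truncate m (u y)‖ₑ ^ 2)
      (Y := fun _ => (m : ℝ≥0∞) ^ 2) (ae_of_all _ fun x => by
        have : ‖truncate m (u x)‖ₑ ≤ m := by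
          rw [← ofReal_norm, ← ENNReal.ofReal_natCast]
          exact ENNReal.ofReal_le_ofReal (norm_truncate_le m _)
        exact pow_le_pow_left' this 2)
    rw [condLExp_const hA] at h
    filter_upwards [h] with x hx
    exact hx.trans_lt (by simp)
  -- For f = 1_s ū_m one gets ‖Tf‖² = ∫_s J K² and ‖f‖² = ∫_s K, so this is ‖Tf‖² ≤ ‖T‖²‖f‖². As s
  -- is arbitrary, J K² ≤ ‖T‖² K a.e., and one factor K cancels where it is nonzero, since the
  -- truncation keeps K finite.
  have hint : ∀ s, MeasurableSet[A] s → (μ.trim hA) s < ∞ →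
      ∫⁻ x in s, J x * K x ^ 2 ∂(μ.trim hA) ≤ ∫⁻ x in s, ‖T‖ₑ ^ 2 * K x ∂(μ.trim hA) := by
    intro s hs hμs
    rw [trim_measurableSet_eq hA hs] at hμs
    have hs' := hA s hs
    rw [setLIntegral_trim hA hJK hs,
      setLIntegral_trim hA (hKm.const_mul _) hs]
    have hmem : MemLp (s.indicator fun y => conj (truncate m (u y))) 2 μ := by
      rw [memLp_indicator_iff_restrict hs']
      have : IsFiniteMeasure (μ.restrict s) := ⟨by simpa using hμs⟩
      refine MemLp.of_bound
        (RCLike.continuous_conj.measurable.comp_aemeasurable hum).aestronglyMeasurable.restrict m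
        (ae_of_all _ fun x => ?_)
      simpa using norm_truncate_le m (u x)
    let f : Lp ℂ 2 μ := hmem.toLp _
    have hf : f =ᵐ[μ] s.indicator fun y => conj (truncate m (u y)) := hmem.coeFn_toLp
    have huf : (fun y => u y * f y) =ᵐ[μ]
        s.indicator fun y => ((‖truncate m (u y)‖ ^ 2 : ℝ) : ℂ) := by
      filter_upwards [hf] with x hx
      rw [hx]
      by_cases hxs : x ∈ s <;> simp [hxs, mul_conj_truncate]
    have hTf : ∀ᵐ x ∂μ, ‖T f x‖ₑ ^ 2 = ‖w x‖ₑ ^ 2 * s.indicator (fun x => K x ^ 2) x := by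
      have hsq : AEMeasurable (fun y => ((‖truncate m (u y)‖ ^ 2 : ℝ) : ℂ)) μ :=
        Complex.measurable_ofReal.comp_aemeasurable (hum.norm.pow_const 2)
      filter_upwards [(hT f).2, condE_congr (A := A) huf, condE_indicator hA hs hsq, hKfin]
        with x h1 h2 h3 h4
      rw [h1, h2, h3, enorm_mul, mul_pow]
      congr 1
      by_cases hxs : x ∈ s
      · rw [Set.indicator_of_mem hxs, Set.indicator_of_mem hxs, condE_norm_sq hA, condSq,
          ← ofReal_norm (_ : ℂ), Complex.norm_real, Real.norm_of_nonneg ENNReal.toReal_nonneg,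
          ENNReal.ofReal_toReal h4.ne]
      · simp [hxs]
    have h1 : ‖T f‖ₑ ^ 2 = ∫⁻ x in s, J x * K x ^ 2 ∂μ := by
      rw [enorm_sq_eq_lintegral, lintegral_congr_ae hTf,
        ← lintegral_mul_condLExp hA ((hKm.pow_const 2).indicator hs) (hw.1.enorm.pow_const 2),
        ← lintegral_indicator hs']
      refine lintegral_congr fun x => ?_
      by_cases hxs : x ∈ s <;> simp [hxs, hJ]
    have h2 : ‖f‖ₑ ^ 2 = ∫⁻ x in s, K x ∂μ := by
      rw [enorm_sq_eq_lintegral, hK, setLIntegral_condLExp hA μ _ hs, ← lintegral_indicator hs']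
      refine lintegral_congr_ae ?_
      filter_upwards [hf] with x hx
      rw [hx]
      by_cases hxs : x ∈ s <;> simp [hxs]
    rw [lintegral_const_mul _ (hKm.mono hA le_rfl), ← h1, ← h2, ← mul_pow]
    exact pow_le_pow_left' (T.le_opENorm f) 2
  have hle := ae_le_of_ae_le_trim (@ae_le_of_forall_setLIntegral_le_of_sigmaFinite X A (μ.trim hA) _
    _ _ hJK hint)
  filter_upwards [hle, hKfin] with x hx hfin
  by_cases h0 : K x = 0
  · simp [h0]
  · rw [sq (K x), ← mul_assoc] at hx
    exact (ENNReal.mul_le_mul_iff_left h0 hfin.ne).1 hx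

/-- Boundedness of `M_w E M_u` implies boundedness of `E(|w|²) E(|u|²)`. -/
lemma condLExp_mul_condLExp_le (hA : A ≤ mX) [SigmaFinite (μ.trim hA)]
    (hu : Conditionable A μ u) (hw : Conditionable A μ w) (T : Lp ℂ 2 μ →L[ℂ] Lp ℂ 2 μ)
    (hT : ∀ f : Lp ℂ 2 μ, IsWCE A μ w u f (T f)) :
    ∀ᵐ x ∂μ, condLExp A μ (fun y => ‖w y‖ₑ ^ 2) x * condLExp A μ (fun y => ‖u y‖ₑ ^ 2) x
      ≤ ‖T‖ₑ ^ 2 := by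
  have hsup := condLExp_iSup hA (μ := μ) (g := fun m y => ‖truncate m (u y)‖ₑ ^ 2)
    (fun m => ((measurable_truncate m).comp_aemeasurable hu.1).enorm.pow_const 2)
    (fun x => monotone_enorm_truncate_sq (u x))
  simp only [iSup_enorm_truncate_sq] at hsup
  filter_upwards [hsup, ae_all_iff.2 (condLExp_mul_condLExp_truncate_le hA hu hw T hT)] with x h1 h2
  rw [h1, ENNReal.mul_iSup]
  exact iSup_le h2

/-- A finite product in [0, ∞] allows an infinite factor only against a zero one, and a vanishing
second moment forces the function itself to vanish. -/
lemma ae_mul_eq_zero_or (hA : A ≤ mX) [SigmaFinite (μ.trim hA)]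
    (hu : Conditionable A μ u) (hw : Conditionable A μ w) {C : ℝ≥0∞} (hC : C ≠ ∞)
    (hle : ∀ᵐ x ∂μ, condLExp A μ (fun y => ‖w y‖ₑ ^ 2) x * condLExp A μ (fun y => ‖u y‖ₑ ^ 2) x
      ≤ C) :
    ∀ᵐ x ∂μ, ((condLExp A μ (fun y => ‖w y‖ₑ ^ 2) x ≠ 0 ∧
      condLExp A μ (fun y => ‖w y‖ₑ ^ 2) x ≠ ∞) ∧ (condLExp A μ (fun y => ‖u y‖ₑ ^ 2) x ≠ 0 ∧
      condLExp A μ (fun y => ‖u y‖ₑ ^ 2) x ≠ ∞)) ∨ u x * w x = 0 := by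
  filter_upwards [hle, ae_eq_zero_of_condLExp_eq_zero hA (hu.1.enorm.pow_const 2),
    ae_eq_zero_of_condLExp_eq_zero hA (hw.1.enorm.pow_const 2)] with x h1 h2 h3
  by_cases hJ : condLExp A μ (fun y => ‖w y‖ₑ ^ 2) x = 0
  · right
    simpa using Or.inr (h3 hJ)
  by_cases hK : condLExp A μ (fun y => ‖u y‖ₑ ^ 2) x = 0
  · right
    simpa using Or.inl (h2 hK)
  refine Or.inl ⟨⟨hJ, fun h => ?_⟩, hK, fun h => ?_⟩
  · rw [h, ENNReal.top_mul hK] at h1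
    exact hC (top_le_iff.1 h1)
  · rw [h, ENNReal.mul_top hJ] at h1
    exact hC (top_le_iff.1 h1)

lemma condLExp_indicator_sq (hA : A ≤ mX) [SigmaFinite (μ.trim hA)] {s : Set X} {f : X → ℂ}
    (hs : MeasurableSet[A] s) (hf : AEMeasurable f μ) :
    condLExp A μ (fun y => ‖s.indicator f y‖ₑ ^ 2) =ᵐ[μ]
      s.indicator (condLExp A μ fun y => ‖f y‖ₑ ^ 2) := by
  rw [show (fun y => ‖s.indicator f y‖ₑ ^ 2) = s.indicator fun y => ‖f y‖ₑ ^ 2 from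
    funext fun y => by by_cases hy : y ∈ s <;> simp [hy]]
  exact condLExp_indicator hA hs (hf.enorm.pow_const 2)

/-- If `E(|w|²) E(|u|²)` is bounded, then `uw` is conditionable, and both second moments are
positive and finite on the support of `E(uw)`. -/
lemma conditionable_mul_and_ae_pos (hA : A ≤ mX) [SigmaFinite (μ.trim hA)]
    (hu : Conditionable A μ u) (hw : Conditionable A μ w) {C : ℝ≥0∞} (hC : C ≠ ∞)
    (hle : ∀ᵐ x ∂μ, condLExp A μ (fun y => ‖w y‖ₑ ^ 2) x * condLExp A μ (fun y => ‖u y‖ₑ ^ 2) x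
      ≤ C) :
    Conditionable A μ (fun x => u x * w x) ∧
    ∀ᵐ x ∂μ, condE A μ (fun y => u y * w y) x ≠ 0 →
      (condLExp A μ (fun y => ‖w y‖ₑ ^ 2) x ≠ 0 ∧ condLExp A μ (fun y => ‖w y‖ₑ ^ 2) x ≠ ∞) ∧
      (condLExp A μ (fun y => ‖u y‖ₑ ^ 2) x ≠ 0 ∧ condLExp A μ (fun y => ‖u y‖ₑ ^ 2) x ≠ ∞) := by
  set J := condLExp A μ (fun y => ‖w y‖ₑ ^ 2) with hJ
  set K := condLExp A μ (fun y => ‖u y‖ₑ ^ 2) with hK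
  let G : Set X := {x | (J x ≠ 0 ∧ J x ≠ ∞) ∧ (K x ≠ 0 ∧ K x ≠ ∞)}
  have hGm (h : X → ℝ≥0∞) (hh : Measurable[A] h) : MeasurableSet[A] {x | h x ≠ 0 ∧ h x ≠ ∞} :=
    hh ((measurableSet_singleton 0).compl.inter (measurableSet_singleton ∞).compl)
  have hG : MeasurableSet[A] G := (hGm J (measurable_condLExp _ _ _)).inter
    (hGm K (measurable_condLExp _ _ _))
  have hzero := ae_mul_eq_zero_or hA hu hw hC hle
  have hfin {f : X → ℂ} (hf : AEMeasurable f μ)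
      (h : ∀ x ∈ G, condLExp A μ (fun y => ‖f y‖ₑ ^ 2) x ≠ ∞) :
      ∀ᵐ x ∂μ, condLExp A μ (fun y => ‖G.indicator f y‖ₑ ^ 2) x < ∞ := by
    filter_upwards [condLExp_indicator_sq hA hG hf] with x hx
    rw [hx]
    by_cases hxG : x ∈ G
    · rw [Set.indicator_of_mem hxG]
      exact (h x hxG).lt_top
    · simp [hxG]
  -- As uw vanishes off G, both functions may be cut down to G, where their second moments are
  -- finite; moreover E(uw) then vanishes off G.
  have hGuw : G.indicator (fun x => u x * w x) =ᵐ[μ] fun x => u x * w x := by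
    filter_upwards [hzero] with x hx
    rcases hx with hx | hx
    · exact Set.indicator_of_mem (s := G) hx _
    · by_cases hxG : x ∈ G <;> simp [hxG, hx]
  have hcond : Conditionable A μ (fun x => u x * w x) := by
    refine (Conditionable.mul_of_sq (hu.1.indicator (hA _ hG)) (hw.1.indicator (hA _ hG))
      (hfin hu.1 fun x hx => hx.2.2) (hfin hw.1 fun x hx => hx.1.2)).congr ?_
    filter_upwards [hGuw] with x hx
    rw [← hx]
    by_cases hxG : x ∈ G <;> simp [hxG]
  refine ⟨hcond, ?_⟩
  filter_upwards [condE_congr (A := A) hGuw, condE_indicator hA hG hcond.1] with x h1 h2 hne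
  by_contra hxG
  rw [← h1, h2] at hne
  exact hne (Set.indicator_of_notMem (s := G) hxG _)

/-- The value `t = JK` in the hypothesis on `α_t`. -/
lemma mul_le_sq_of_forall_nonneg {e J K : ℝ} (he : 0 < e) (hJ : 0 < J) (hK : 0 < K) {n k : ℕ}
    (hk : 1 ≤ k)
    (h : ∀ t : ℝ, 0 < t → 0 ≤ e ^ (2 * (n + k)) * J
      - (1 + n) * t ^ n * e ^ (2 * (k - 1)) * 1 * J ^ 2 * K
      + n * t ^ (n + 1) * e ^ (2 * (k - 1)) * 1 * J) : J * K ≤ e ^ 2 := by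
  obtain ⟨l, rfl⟩ := Nat.exists_eq_add_of_le' hk
  -- The dependence on t is through n t^{n+1} - (n+1) t^n JK, which is smallest at t = JK, where it
  -- equals -(JK)^{n+1}.
  have h1 := h (J * K) (mul_pos hJ hK)
  have h2 : 0 ≤ (e ^ (2 * l) * J) * ((e ^ 2) ^ (n + 1) - (J * K) ^ (n + 1)) := by
    rw [Nat.add_sub_cancel] at h1
    convert h1 using 1
    ring
  have h3 := nonneg_of_mul_nonneg_right h2 (by positivity)
  exact (pow_le_pow_iff_left₀ (by positivity) (by positivity) (Nat.succ_ne_zero n)).1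
    (sub_nonneg.1 h3)

/-- The exceptional null set depends on t, while the value t = JK varies with the point. Rational t
give one null set, and continuity in t then reaches every t > 0. -/
lemma ae_condSq_mul_le_sq {n k : ℕ} (hk : 1 ≤ k)
    (hα : ∀ t : ℝ, 0 < t → ∀ᵐ x ∂μ, 0 ≤ alpha A μ w u n k t x) :
    ∀ᵐ x ∂μ, condE A μ (fun y => u y * w y) x ≠ 0 → 0 < condSq A μ w x → 0 < condSq A μ u x →
      condSq A μ w x * condSq A μ u x ≤ ‖condE A μ (fun y => u y * w y) x‖ ^ 2 := by
  have hQ : ∀ᵐ x ∂μ, ∀ q : ℚ, 0 < (q : ℝ) → 0 ≤ alpha A μ w u n k q x :=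
    ae_all_iff.2 fun q => by
      by_cases hq : 0 < (q : ℝ)
      · filter_upwards [hα q hq] with x hx _ using hx
      · exact ae_of_all _ fun x h => absurd h hq
  filter_upwards [hQ] with x hx he hJ hK
  refine mul_le_sq_of_forall_nonneg (norm_pos_iff.2 he) hJ hK hk (n := n) fun t ht => ?_
  have hcont : Continuous fun t : ℝ => alpha A μ w u n k t x := by
    unfold alpha
    fun_prop
  have hdense : t ∈ closure (Set.Ioi (0 : ℝ) ∩ Set.range ((↑) : ℚ → ℝ)) :=
    Rat.denseRange_cast.open_subset_closure_inter isOpen_Ioi ht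
  have hmem := closure_minimal (t := {t : ℝ | 0 ≤ alpha A μ w u n k t x})
    (by rintro _ ⟨hq, q, rfl⟩; exact hx q hq) (isClosed_le continuous_const hcont) hdense
  simpa only [Set.mem_ofPred_eq, alpha, if_neg he] using hmem

/-- The case of equality in the conditional Cauchy-Schwarz inequality. -/
lemma ae_eq_mul_conj_of_le (hA : A ≤ mX) [SigmaFinite (μ.trim hA)] {s : Set X}
    (hu : AEMeasurable u μ) (hw : AEMeasurable w μ)
    (hu2 : ∀ᵐ x ∂μ, condLExp A μ (fun y => ‖u y‖ₑ ^ 2) x < ∞)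
    (hw2 : ∀ᵐ x ∂μ, condLExp A μ (fun y => ‖w y‖ₑ ^ 2) x < ∞)
    (hpos : ∀ᵐ x ∂μ, x ∈ s → 0 < condSq A μ w x)
    (hle : ∀ᵐ x ∂μ, x ∈ s →
      condSq A μ w x * condSq A μ u x ≤ ‖condE A μ (fun y => u y * w y) x‖ ^ 2) :
    ∀ᵐ x ∂μ, x ∈ s →
      u x = condE A μ (fun y => u y * w y) x / condSq A μ w x * conj (w x) := by
  set e := condE A μ (fun y => u y * w y) with he
  -- The coefficient of the conditional orthogonal projection of u onto w̄. The remainder d = u - c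
  -- w̄ satisfies E(|d|²) J = JK - |e|² wherever J > 0, so the assumed inequality forces d = 0.
  set c : X → ℂ := fun x => e x / condSq A μ w x with hc
  have hcm : Measurable[A] c := (measurable_condE A μ _).div
    (Complex.measurable_ofReal.comp (measurable_condSq A μ w))
  have hcm' : Measurable[A] fun x => conj (c x) := RCLike.continuous_conj.measurable.comp hcm
  have huw : Conditionable A μ (fun y => u y * w y) := Conditionable.mul_of_sq hu hw hu2 hw2
  have hsq {f : X → ℂ} (hf : AEMeasurable f μ)
      (hf2 : ∀ᵐ x ∂μ, condLExp A μ (fun y => ‖f y‖ₑ ^ 2) x < ∞) :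
      Conditionable A μ (fun y => ((‖f y‖ ^ 2 : ℝ) : ℂ)) :=
    Conditionable.mono (Complex.measurable_ofReal.comp_aemeasurable (hf.norm.pow_const 2))
      (ae_of_all _ fun x => (enorm_ofReal_norm_sq (f x)).le) hf2
  have hcc : Measurable[A] fun x => c x * conj (c x) := hcm.mul hcm'
  have c1 := hsq hu hu2
  have c2 := (hsq hw hw2).mul hA hcc
  have c3 := huw.mul hA hcm'.neg
  have c4 := huw.conj.mul hA hcm.neg
  set d : X → ℂ := fun x => u x - c x * conj (w x) with hd
  have hexp : (fun x => ((‖d x‖ ^ 2 : ℝ) : ℂ)) = fun x =>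
      (((‖u x‖ ^ 2 : ℝ) : ℂ) + c x * conj (c x) * ((‖w x‖ ^ 2 : ℝ) : ℂ)) +
      ((-fun x => conj (c x)) x * (u x * w x) + (-c) x * conj (u x * w x)) := by
    ext x
    push_cast
    simp only [← Complex.mul_conj', hd, map_sub, map_mul, Complex.conj_conj, Pi.neg_apply]
    ring
  have hdm : AEMeasurable d μ := hu.sub ((hcm.mono hA le_rfl).aemeasurable.mul
    (RCLike.continuous_conj.measurable.comp_aemeasurable hw))
  have hdc : Conditionable A μ (fun x => ((‖d x‖ ^ 2 : ℝ) : ℂ)) := by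
    rw [hexp]
    exact (c1.add c2).add (c3.add c4)
  have hdfin : ∀ᵐ x ∂μ, condLExp A μ (fun y => ‖d y‖ₑ ^ 2) x < ∞ := by
    refine hdc.2.mono fun x hx => ?_
    simpa only [enorm_ofReal_norm_sq] using hx
  have hE := condE_add hA (c1.add c2) (c3.add c4)
  rw [← hexp] at hE
  filter_upwards [hE, condE_add hA c1 c2, condE_add hA c3 c4, condE_mul hA hcc (hsq hw hw2),
    condE_mul hA hcm'.neg huw, condE_mul hA hcm.neg huw.conj, hdfin, hpos, hle,
    ae_eq_zero_of_condLExp_eq_zero hA (hdm.enorm.pow_const 2)]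
    with x h1 h2 h3 h4 h5 h6 hfin hpos hle hz hxs
  rw [h2, h3, h4, h5, h6, condE_conj, condE_norm_sq hA, condE_norm_sq hA, condE_norm_sq hA,
    ← he] at h1
  have hJ := hpos hxs
  have hJ0 : (condSq A μ w x : ℂ) ≠ 0 := by exact_mod_cast hJ.ne'
  have hval : (condSq A μ d x : ℂ) * condSq A μ w x =
      ((condSq A μ w x * condSq A μ u x - ‖e x‖ ^ 2 : ℝ) : ℂ) := by
    rw [h1]
    push_cast
    rw [← Complex.mul_conj']
    simp only [hc, Pi.neg_apply, map_div₀, Complex.conj_ofReal]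
    field_simp
    ring
  have hval' : condSq A μ d x * condSq A μ w x ≤ 0 := by
    have : condSq A μ d x * condSq A μ w x = condSq A μ w x * condSq A μ u x - ‖e x‖ ^ 2 := by
      exact_mod_cast hval
    rw [this]
    linarith [hle hxs]
  have hd0 : condSq A μ d x = 0 :=
    le_antisymm (nonpos_of_mul_nonpos_left hval' hJ) ENNReal.toReal_nonneg
  have hd0' : condLExp A μ (fun y => ‖d y‖ₑ ^ 2) x = 0 :=
    ((ENNReal.toReal_eq_zero_iff _).1 hd0).resolve_right hfin.ne
  have : d x = 0 := by simpa using hz hd0'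
  exact sub_eq_zero.1 this

end Structure

/-! ### The operator M_w E M_u, its reducing projection and its normal part -/

section WeightedOperator

variable {X : Type*} {A mX : MeasurableSpace X} {μ : Measure X} {u w : X → ℂ}

lemma exists_indicator_clm (μ : Measure[mX] X) {s : Set X} (hs : MeasurableSet s) :
    ∃ P : Lp ℂ 2 μ →L[ℂ] Lp ℂ 2 μ, ∀ f : Lp ℂ 2 μ, P f =ᵐ[μ] s.indicator f := by
  have hm (f : Lp ℂ 2 μ) : MemLp (s.indicator f) 2 μ := (Lp.memLp f).indicator hs
  refine ⟨LinearMap.mkContinuous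
    { toFun := fun f => (hm f).toLp _
      map_add' := fun f g => ?_
      map_smul' := fun a f => ?_ } 1 fun f => ?_, fun f => (hm f).coeFn_toLp⟩
  · apply Lp.ext
    filter_upwards [(hm (f + g)).coeFn_toLp, Lp.coeFn_add ((hm f).toLp _) ((hm g).toLp _),
      (hm f).coeFn_toLp, (hm g).coeFn_toLp, Lp.coeFn_add f g] with x h1 h2 h3 h4 h5
    rw [h1, h2, Pi.add_apply, h3, h4]
    by_cases hx : x ∈ s
    · simpa only [Set.indicator_of_mem hx, Pi.add_apply] using h5
    · simp [hx]
  · apply Lp.ext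
    filter_upwards [(hm (a • f)).coeFn_toLp, Lp.coeFn_smul a ((hm f).toLp _),
      (hm f).coeFn_toLp, Lp.coeFn_smul a f] with x h1 h2 h3 h4
    rw [h1, RingHom.id_apply, h2, Pi.smul_apply, h3]
    by_cases hx : x ∈ s <;> simp [hx, h4]
  · rw [one_mul]
    refine Lp.norm_le_norm_of_ae_le ?_
    filter_upwards [(hm f).coeFn_toLp] with x hx
    exact (congrArg norm hx).le.trans (norm_indicator_le_norm_self _ _)

lemma indicator_clm_adjoint {s : Set X} {P : Lp ℂ 2 μ →L[ℂ] Lp ℂ 2 μ}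
    (hP : ∀ f : Lp ℂ 2 μ, P f =ᵐ[μ] s.indicator f) : ContinuousLinearMap.adjoint P = P := by
  refine ((ContinuousLinearMap.eq_adjoint_iff P P).2 fun f g => ?_).symm
  rw [L2.inner_def, L2.inner_def]
  refine integral_congr_ae ?_
  filter_upwards [hP f, hP g] with x h1 h2
  rw [h1, h2]
  by_cases hx : x ∈ s <;> simp [hx]

lemma indicator_clm_idem {s : Set X} {P : Lp ℂ 2 μ →L[ℂ] Lp ℂ 2 μ}
    (hP : ∀ f : Lp ℂ 2 μ, P f =ᵐ[μ] s.indicator f) (f : Lp ℂ 2 μ) : P (P f) = P f := by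
  apply Lp.ext
  filter_upwards [hP f, hP (P f)] with x h1 h2
  rw [h2]
  by_cases hx : x ∈ s <;> simp [hx, h1]

/-- The value of `M_w E M_u` on the product of an element of `L²` with a function measurable with
respect to the sub-σ-algebra. -/
lemma IsWCE.ae_eq_mul (hA : A ≤ mX) [SigmaFinite (μ.trim hA)] {f f' g g' : Lp ℂ 2 μ} {a : X → ℂ}
    (ha : Measurable[A] a) (hg : IsWCE A μ w u f g) (hg' : IsWCE A μ w u f' g')
    (hf' : ∀ᵐ x ∂μ, f' x = a x * f x) : ∀ᵐ x ∂μ, g' x = a x * g x := by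
  have h : (fun y => u y * f' y) =ᵐ[μ] fun y => a y * (u y * f y) := by
    filter_upwards [hf'] with x hx
    rw [hx]; ring
  filter_upwards [hg.2, hg'.2, condE_congr (A := A) h, condE_mul hA ha hg.1] with x h1 h2 h3 h4
  rw [h1, h2, h3, h4]; ring

/-- `M_w E M_u` commutes with multiplication by indicators of sets of the sub-σ-algebra. -/
lemma comm_indicator_clm (hA : A ≤ mX) [SigmaFinite (μ.trim hA)] {T P : Lp ℂ 2 μ →L[ℂ] Lp ℂ 2 μ}
    (hT : ∀ f : Lp ℂ 2 μ, IsWCE A μ w u f (T f)) {s : Set X} (hs : MeasurableSet[A] s)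
    (hP : ∀ f : Lp ℂ 2 μ, P f =ᵐ[μ] s.indicator f) (f : Lp ℂ 2 μ) : T (P f) = P (T f) := by
  apply Lp.ext
  have h := IsWCE.ae_eq_mul hA (a := s.indicator 1)
    (Measurable.indicator (@measurable_const _ _ _ A 1) hs) (hT f) (hT (P f)) (by
      filter_upwards [hP f] with x hx
      rw [hx]
      by_cases hxs : x ∈ s <;> simp [hxs])
  filter_upwards [h, hP (T f)] with x h1 h2
  rw [h1, h2]
  by_cases hxs : x ∈ s <;> simp [hxs]

/-- `(M_w E M_u)² = M_{E(uw)} M_w E M_u` vanishes off the support of `E(uw)`. -/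
lemma sq_indicator_clm (hA : A ≤ mX) [SigmaFinite (μ.trim hA)] {T P : Lp ℂ 2 μ →L[ℂ] Lp ℂ 2 μ}
    (hT : ∀ f : Lp ℂ 2 μ, IsWCE A μ w u f (T f)) (huw : Conditionable A μ fun y => u y * w y)
    (hP : ∀ f : Lp ℂ 2 μ, P f =ᵐ[μ] {x | condE A μ (fun y => u y * w y) x ≠ 0}.indicator f)
    (f : Lp ℂ 2 μ) : T (T (P f)) = T (T f) := by
  have key (g : Lp ℂ 2 μ) : T (T g) =ᵐ[μ] fun x =>
      condE A μ (fun y => u y * w y) x * T g x := by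
    have h : (fun y => u y * T g y) =ᵐ[μ]
        fun y => condE A μ (fun y => u y * g y) y * (u y * w y) := by
      filter_upwards [(hT g).2] with x hx
      rw [hx]; ring
    filter_upwards [(hT (T g)).2, (hT g).2, condE_congr (A := A) h,
      condE_mul hA (measurable_condE A μ _) huw] with x h1 h2 h3 h4
    rw [h1, h2, h3, h4]; ring
  have hs : MeasurableSet[A] {x | condE A μ (fun y => u y * w y) x ≠ 0} :=
    (measurable_condE A μ _) (measurableSet_singleton 0).compl
  apply Lp.ext
  filter_upwards [key f, key (P f), hP (T f)] with x h1 h2 h3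
  rw [h1, h2, comm_indicator_clm hA hT hs hP, h3]
  by_cases hx : condE A μ (fun y => u y * w y) x = 0
  · simp [hx]
  · rw [Set.indicator_of_mem (s := {x | condE A μ (fun y => u y * w y) x ≠ 0}) hx]

/-- If `u = c w̄` on a set of the sub-σ-algebra, then there `M_w E M_u` is multiplication by `c`
after the positive operator `M_w E M_w̄`. -/
lemma ae_eq_of_eq_mul_conj (hA : A ≤ mX) [SigmaFinite (μ.trim hA)] {T P : Lp ℂ 2 μ →L[ℂ] Lp ℂ 2 μ}
    (hT : ∀ f : Lp ℂ 2 μ, IsWCE A μ w u f (T f)) {s : Set X} (hs : MeasurableSet[A] s)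
    (hP : ∀ f : Lp ℂ 2 μ, P f =ᵐ[μ] s.indicator f) {c : X → ℂ} (hc : Measurable[A] c)
    (huc : ∀ᵐ x ∂μ, x ∈ s → u x = c x * conj (w x)) {f : Lp ℂ 2 μ}
    (hwf : Conditionable A μ fun x => conj (s.indicator w x) * f x) :
    ∀ᵐ x ∂μ, T (P f) x =
      c x * s.indicator w x * condE A μ (fun x => conj (s.indicator w x) * f x) x := by
  have h : (fun y => u y * P f y) =ᵐ[μ] fun y => c y * (conj (s.indicator w y) * f y) := by
    filter_upwards [hP f, huc] with x h1 h2
    rw [h1]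
    by_cases hx : x ∈ s
    · simp [hx, h2 hx, mul_assoc]
    · simp [hx]
  filter_upwards [(hT (P f)).2, condE_congr (A := A) h, condE_mul hA hc hwf, hP (P f), hP (T (P f))]
    with x h1 h2 h3 h4 h5
  -- Since TPf = P(TPf), the left side is supported in s, so w may be replaced by its restriction to
  -- s.
  rw [← indicator_clm_idem hP, comm_indicator_clm hA hT hs hP, h5]
  by_cases hx : x ∈ s
  · rw [Set.indicator_of_mem hx, Set.indicator_of_mem hx, h1, h2, h3]; ring
  · simp [hx]

/-- `M_a M_v E M_v̄` is adjoint to `M_ā M_v E M_v̄`. -/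
lemma inner_eq_inner_of_ae_eq (hA : A ≤ mX) [SigmaFinite (μ.trim hA)] {c v : X → ℂ}
    (hc : Measurable[A] c) {f g f' g' : Lp ℂ 2 μ}
    (hvf : Conditionable A μ fun x => conj (v x) * f x)
    (hvg : Conditionable A μ fun x => conj (v x) * g x)
    (hf' : ∀ᵐ x ∂μ, f' x = c x * v x * condE A μ (fun x => conj (v x) * f x) x)
    (hg' : ∀ᵐ x ∂μ, g' x = conj (c x) * v x * condE A μ (fun x => conj (v x) * g x) x) :
    inner ℂ f' g = inner ℂ f g' := by
  have hconj : Measurable (conj : ℂ → ℂ) := RCLike.continuous_conj.measurable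
  set F := condE A μ (fun x => conj (v x) * f x) with hF
  set G := condE A μ (fun x => conj (v x) * g x) with hG
  have hFm : Measurable[A] F := measurable_condE A μ _
  have hGm : Measurable[A] G := measurable_condE A μ _
  have h1 : (fun x => inner ℂ (f' x) (g x)) =ᵐ[μ]
      fun x => (conj (c x) * conj (F x)) * (conj (v x) * g x) := by
    filter_upwards [hf'] with x hx
    simp only [RCLike.inner_apply, hx, map_mul]; ring
  have h2 : (fun x => inner ℂ (f x) (g' x)) =ᵐ[μ]
      fun x => (conj (c x) * G x) * conj (conj (v x) * f x) := by
    filter_upwards [hg'] with x hx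
    simp only [RCLike.inner_apply, hx, map_mul, Complex.conj_conj]; ring
  have m1 : Measurable[A] fun x => conj (c x) * conj (F x) :=
    (hconj.comp hc).mul (hconj.comp hFm)
  have m2 : Measurable[A] fun x => conj (c x) * G x := (hconj.comp hc).mul hGm
  -- The two integrands need not agree pointwise, but their conditional expectations do: both are c̄
  -- F̄ G.
  rw [L2.inner_def, L2.inner_def, ← integral_condE hA (L2.integrable_inner f' g),
    ← integral_condE hA (L2.integrable_inner f g')]
  refine integral_congr_ae ?_
  filter_upwards [condE_congr (A := A) h1, condE_congr (A := A) h2, condE_mul hA m1 hvg,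
    condE_mul hA m2 hvf.conj] with x h1 h2 h3 h4
  rw [h1, h2, h3, h4, condE_conj, ← hF, ← hG]; ring

/-- The adjoint of `M_c M_v E M_v̄` is `M_c̄ M_v E M_v̄`; in particular this operator is normal. -/
lemma adjoint_ae_eq (hA : A ≤ mX) [SigmaFinite (μ.trim hA)] {c v : X → ℂ}
    (hc : Measurable[A] c) (hv : AEMeasurable v μ)
    (hvf : ∀ f : Lp ℂ 2 μ, Conditionable A μ fun x => conj (v x) * f x)
    {N : Lp ℂ 2 μ →L[ℂ] Lp ℂ 2 μ}
    (hN : ∀ f : Lp ℂ 2 μ, ∀ᵐ x ∂μ, N f x = c x * v x * condE A μ (fun x => conj (v x) * f x) x)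
    (g : Lp ℂ 2 μ) : ∀ᵐ x ∂μ, ContinuousLinearMap.adjoint N g x =
      conj (c x) * v x * condE A μ (fun x => conj (v x) * g x) x := by
  -- The candidate for N*g has the same modulus as Ng at almost every point, hence lies in L².
  have hmem : MemLp (fun x => conj (c x) * v x * condE A μ (fun x => conj (v x) * g x) x) 2 μ := by
    refine (Lp.memLp (N g)).mono ?_ ?_
    · exact (((RCLike.continuous_conj.measurable.comp (hc.mono hA le_rfl)).aemeasurable.mul hv).mul
        ((measurable_condE A μ _).mono hA le_rfl).aemeasurable).aestronglyMeasurable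
    · filter_upwards [hN g] with x hx
      simp [hx]
  have heq : ContinuousLinearMap.adjoint N g = hmem.toLp _ := by
    refine ext_inner_left ℂ fun f => ?_
    rw [ContinuousLinearMap.adjoint_inner_right]
    exact inner_eq_inner_of_ae_eq hA hc (hvf f) (hvf g) (hN f) hmem.coeFn_toLp
  rw [heq]
  exact hmem.coeFn_toLp

lemma isStarNormal_of_ae_eq (hA : A ≤ mX) [SigmaFinite (μ.trim hA)] {c v : X → ℂ}
    (hc : Measurable[A] c) (hv : AEMeasurable v μ)
    (hvf : ∀ f : Lp ℂ 2 μ, Conditionable A μ fun x => conj (v x) * f x)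
    {N : Lp ℂ 2 μ →L[ℂ] Lp ℂ 2 μ}
    (hN : ∀ f : Lp ℂ 2 μ, ∀ᵐ x ∂μ, N f x = c x * v x * condE A μ (fun x => conj (v x) * f x) x) :
    IsStarNormal N := by
  refine ContinuousLinearMap.isStarNormal_iff_norm_eq_adjoint.2 fun g => ?_
  rw [Lp.norm_def, Lp.norm_def]
  congr 1
  refine eLpNorm_congr_norm_ae ?_
  filter_upwards [hN g, adjoint_ae_eq hA hc hv hvf hN g] with x h1 h2
  simp [h1, h2]

/-- Under the hypothesis on `α_t`, on the support of `E(uw)` the function `u` is a multiple of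
`w̄` by a function measurable with respect to the sub-σ-algebra. -/
lemma exists_eq_mul_conj (hA : A ≤ mX) [SigmaFinite (μ.trim hA)]
    (hu : Conditionable A μ u) (hw : Conditionable A μ w) {C : ℝ≥0∞} (hC : C ≠ ∞)
    (hle : ∀ᵐ x ∂μ, condLExp A μ (fun y => ‖w y‖ₑ ^ 2) x * condLExp A μ (fun y => ‖u y‖ₑ ^ 2) x
      ≤ C) {n k : ℕ} (hk : 1 ≤ k)
    (hα : ∀ t : ℝ, 0 < t → ∀ᵐ x ∂μ, 0 ≤ alpha A μ w u n k t x) :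
    (∀ᵐ x ∂μ, condLExp A μ
      (fun y => ‖{x | condE A μ (fun y => u y * w y) x ≠ 0}.indicator w y‖ₑ ^ 2) x < ∞) ∧
    ∃ c : X → ℂ, Measurable[A] c ∧
      ∀ᵐ x ∂μ, condE A μ (fun y => u y * w y) x ≠ 0 → u x = c x * conj (w x) := by
  obtain ⟨huw, hpos⟩ := conditionable_mul_and_ae_pos hA hu hw hC hle
  set s : Set X := {x | condE A μ (fun y => u y * w y) x ≠ 0} with hsdef
  have hs : MeasurableSet[A] s := (measurable_condE A μ _) (measurableSet_singleton 0).compl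
  have hfin {f : X → ℂ} (hf : AEMeasurable f μ)
      (h : ∀ᵐ x ∂μ, x ∈ s → condLExp A μ (fun y => ‖f y‖ₑ ^ 2) x ≠ ∞) :
      ∀ᵐ x ∂μ, condLExp A μ (fun y => ‖s.indicator f y‖ₑ ^ 2) x < ∞ := by
    filter_upwards [condLExp_indicator_sq hA hs hf, h] with x hx h
    rw [hx]
    by_cases hxs : x ∈ s
    · rw [Set.indicator_of_mem hxs]
      exact (h hxs).lt_top
    · simp [hxs]
  have hu2 := hfin hu.1 (hpos.mono fun x h hx => (h hx).2.2)
  have hw2 := hfin hw.1 (hpos.mono fun x h hx => (h hx).1.2)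
  have hSq {f : X → ℂ} (hf : AEMeasurable f μ) :
      ∀ᵐ x ∂μ, x ∈ s → condSq A μ (s.indicator f) x = condSq A μ f x := by
    filter_upwards [condLExp_indicator_sq hA hs hf] with x hx hxs
    rw [condSq, hx, Set.indicator_of_mem hxs, condSq]
  have hE : ∀ᵐ x ∂μ, x ∈ s → condE A μ (fun y => s.indicator u y * s.indicator w y) x =
      condE A μ (fun y => u y * w y) x := by
    have : (fun y => s.indicator u y * s.indicator w y) = s.indicator fun y => u y * w y :=
      funext fun y => by by_cases hy : y ∈ s <;> simp [hy]
    rw [this]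
    filter_upwards [condE_indicator hA hs huw.1] with x hx hxs
    rw [hx, Set.indicator_of_mem hxs]
  have hJpos : ∀ᵐ x ∂μ, x ∈ s → 0 < condSq A μ w x :=
    hpos.mono fun x h hx => ENNReal.toReal_pos (h hx).1.1 (h hx).1.2
  have hKpos : ∀ᵐ x ∂μ, x ∈ s → 0 < condSq A μ u x :=
    hpos.mono fun x h hx => ENNReal.toReal_pos (h hx).2.1 (h hx).2.2
  refine ⟨hw2, fun x => condE A μ (fun y => s.indicator u y * s.indicator w y) x /
    condSq A μ (s.indicator w) x, (measurable_condE A μ _).div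
      (Complex.measurable_ofReal.comp (measurable_condSq A μ _)), ?_⟩
  -- Off s the second moments of u and w may be infinite, so the equality case is applied to their
  -- restrictions to s.
  have key := ae_eq_mul_conj_of_le hA (s := s) (hu.1.indicator (hA _ hs)) (hw.1.indicator (hA _ hs))
    hu2 hw2 (by filter_upwards [hSq hw.1, hJpos] with x h1 h2 hx; rw [h1 hx]; exact h2 hx) (by
      filter_upwards [hSq hw.1, hSq hu.1, hE, ae_condSq_mul_le_sq hk hα, hJpos, hKpos]
        with x h1 h2 h3 h4 h5 h6 hx
      rw [h1 hx, h2 hx, h3 hx]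
      exact h4 hx (h5 hx) (h6 hx))
  filter_upwards [key] with x h hx
  have h' := h hx
  rwa [Set.indicator_of_mem (s := s) hx, Set.indicator_of_mem (s := s) hx] at h'

end WeightedOperator

/-! ### Spectral consequences of the decomposition into a normal and a square-zero operator -/

section NormalPlusNilpotent

variable {H : Type*} [NormedAddCommGroup H] [InnerProductSpace ℂ H]

lemma shift_apply (T : H →L[ℂ] H) (z : ℂ) (x : H) : shift T z x = T x - z • x := rfl

lemma mem_kernel_iff (T : H →L[ℂ] H) (x : H) : x ∈ kernel T ↔ T x = 0 := Iff.rfl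

variable [CompleteSpace H] {T P : H →L[ℂ] H}

lemma norm_shift_adjoint {N : H →L[ℂ] H} (hN : IsStarNormal N) (z : ℂ) (x : H) :
    ‖shift (ContinuousLinearMap.adjoint N) (conj z) x‖ = ‖shift N z x‖ := by
  have h : IsStarNormal (shift N z) := by
    refine ⟨?_⟩
    have h1 : shift N z = N - algebraMap ℂ (H →L[ℂ] H) z := by
      rw [Algebra.algebraMap_eq_smul_one]; rfl
    rw [h1, star_sub, ← algebraMap_star_comm]
    exact ((hN.star_comm_self.sub_right (Algebra.commutes _ _).symm).sub_left
      (Algebra.commutes _ _))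
  have h2 : ContinuousLinearMap.adjoint (shift N z) =
      shift (ContinuousLinearMap.adjoint N) (conj z) := by
    unfold shift
    rw [map_sub, map_smulₛₗ, ContinuousLinearMap.adjoint_id]
  rw [← h2]
  exact (ContinuousLinearMap.isStarNormal_iff_norm_eq_adjoint.1 h x).symm

/-- An operator `T` is the orthogonal sum of a normal operator and of an operator with square zero,
with respect to the decomposition given by a reducing projection `P`. -/
structure IsNormalPlusNilpotent (T P : H →L[ℂ] H) : Prop where
  comm : ∀ x, T (P x) = P (T x)
  idem : ∀ x, P (P x) = P x
  adjoint_eq : ContinuousLinearMap.adjoint P = P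
  sq_eq : ∀ x, T (T (P x)) = T (T x)
  normal : IsStarNormal (T ∘L P)

namespace IsNormalPlusNilpotent

lemma adjoint_comp_apply (h : IsNormalPlusNilpotent T P) (x : H) :
    ContinuousLinearMap.adjoint (T ∘L P) x = ContinuousLinearMap.adjoint T (P x) := by
  have : T ∘L P = P ∘L T := ContinuousLinearMap.ext h.comm
  rw [this, ContinuousLinearMap.adjoint_comp, h.adjoint_eq]
  rfl

lemma norm_shift_adjoint_proj (h : IsNormalPlusNilpotent T P) (z : ℂ) (x : H) :
    ‖shift (ContinuousLinearMap.adjoint T) (conj z) (P x)‖ = ‖shift T z (P x)‖ := by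
  have := norm_shift_adjoint h.normal z (P x)
  rw [shift_apply, shift_apply, h.adjoint_comp_apply, ContinuousLinearMap.comp_apply, h.idem] at this
  exact this

/-- On the complement of the normal part, `T - z` is bounded below for `z ≠ 0`. -/
lemma sq_smul_sub (h : IsNormalPlusNilpotent T P) (z : ℂ) (x : H) :
    (z ^ 2) • (x - P x) = -(shift T z (shift T z (x - P x)) + (2 * z) • shift T z (x - P x)) := by
  -- With S = T - z and y = x - Px, the identity is the expansion of 0 = T²y = (S + z)²y.
  have h0 : T (T (x - P x)) = 0 := by rw [map_sub, map_sub, h.sq_eq, sub_self]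
  simp only [shift_apply, map_sub T, map_smul] at *
  rw [h0]
  module

lemma shift_sub_proj (h : IsNormalPlusNilpotent T P) (z : ℂ) (x : H) :
    shift T z (x - P x) = shift T z x - P (shift T z x) := by
  simp only [shift_apply, map_sub, map_smul, h.comm]

lemma shift_proj (h : IsNormalPlusNilpotent T P) (z : ℂ) (x : H) :
    shift T z (P x) = P (shift T z x) := by
  simp only [shift_apply, map_sub, map_smul, h.comm]

/-- A square-zero operator has no nonzero eigenvalue, so such eigenvectors lie in the normal part.
-/
lemma proj_eq_self (h : IsNormalPlusNilpotent T P) {z : ℂ} (hz : z ≠ 0) {x : H}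
    (hx : shift T z x = 0) : P x = x := by
  have h1 := h.sq_smul_sub z x
  rw [h.shift_sub_proj, hx] at h1
  simp only [map_zero, sub_zero, smul_zero, add_zero, neg_zero, smul_eq_zero, pow_eq_zero_iff,
    ne_eq, OfNat.ofNat_ne_zero, not_false_eq_true, hz, false_or] at h1
  exact (sub_eq_zero.1 h1).symm

lemma shift_adjoint_eq_zero (h : IsNormalPlusNilpotent T P) {z : ℂ} (hz : z ≠ 0) {x : H}
    (hx : shift T z x = 0) : shift (ContinuousLinearMap.adjoint T) (conj z) x = 0 := by
  have h1 := h.norm_shift_adjoint_proj z x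
  rw [h.proj_eq_self hz hx, hx, norm_zero, norm_eq_zero] at h1
  exact h1

lemma jointPointSpectrum_diff (h : IsNormalPlusNilpotent T P) :
    jointPointSpectrum T \ {0} = pointSpectrum T \ {0} := by
  ext z
  refine ⟨fun ⟨⟨x, hx, h1, _⟩, hz⟩ => ⟨⟨x, hx, h1⟩, hz⟩, fun ⟨⟨x, hx, h1⟩, hz⟩ => ⟨⟨x, hx, h1, ?_⟩, hz⟩⟩
  exact h.shift_adjoint_eq_zero hz h1

/-- Because T - z is bounded below on the range of 1 - P, the components x_j - P x_j tend to 0; on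
the components P x_j normality gives equal norms for T - z and its adjoint. -/
lemma jointApproxPointSpectrum_diff (h : IsNormalPlusNilpotent T P) :
    jointApproxPointSpectrum T \ {0} = approxPointSpectrum T \ {0} := by
  ext z
  refine ⟨fun ⟨⟨x, hx, h1, _⟩, hz⟩ => ⟨⟨x, hx, h1⟩, hz⟩, fun ⟨⟨x, hx, h1⟩, hz⟩ => ⟨⟨x, hx, h1, ?_⟩, hz⟩⟩
  have hP (S : H →L[ℂ] H) {y : ℕ → H} (hy : Tendsto y atTop (𝓝 0)) :
      Tendsto (fun j => S (y j)) atTop (𝓝 0) := by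
    have h := (S.continuous.tendsto 0).comp hy
    rwa [map_zero] at h
  have h2 : Tendsto (fun j => shift T z (x j - P (x j))) atTop (𝓝 0) := by
    simpa only [h.shift_sub_proj, sub_zero] using h1.sub (hP P h1)
  have h3 : Tendsto (fun j => x j - P (x j)) atTop (𝓝 0) := by
    have h4 : Tendsto (fun j => (z ^ 2) • (x j - P (x j))) atTop (𝓝 0) := by
      simpa only [h.sq_smul_sub, smul_zero, add_zero, neg_zero] using
        ((hP (shift T z) h2).add (h2.const_smul (2 * z))).neg
    have h5 := h4.const_smul ((z ^ 2)⁻¹)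
    simpa only [smul_zero, inv_smul_smul₀ (pow_ne_zero 2 hz)] using h5
  have h4 : Tendsto (fun j => shift (ContinuousLinearMap.adjoint T) (conj z) (P (x j)))
      atTop (𝓝 0) := by
    rw [tendsto_zero_iff_norm_tendsto_zero]
    simp only [h.norm_shift_adjoint_proj, h.shift_proj]
    exact tendsto_zero_iff_norm_tendsto_zero.1 (hP P h1)
  have h5 := (hP (shift (ContinuousLinearMap.adjoint T) (conj z)) h3).add h4
  simpa only [← map_add, sub_add_cancel, add_zero] using h5

lemma inner_eq_zero (h : IsNormalPlusNilpotent T P) {z z' : ℂ} (hne : z ≠ z') {x y : H}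
    (hx : shift T z x = 0) (hy : shift T z' y = 0) : inner ℂ x y = 0 := by
  -- At most one eigenvalue is 0, and it is enough that one of the two eigenvectors is also an
  -- eigenvector of the adjoint.
  wlog hz : z' ≠ 0 generalizing z z' x y
  · have hz0 : z' = 0 := not_not.1 hz
    exact inner_eq_zero_symm.1 (this hne.symm hy hx fun h0 => hne (h0.trans hz0.symm))
  have h1 := h.shift_adjoint_eq_zero hz hy
  rw [shift_apply, sub_eq_zero] at h1 hx
  have h2 := ContinuousLinearMap.adjoint_inner_right T x y
  rw [h1, hx, inner_smul_right, inner_smul_left] at h2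
  have h3 : (conj z' - conj z) * inner ℂ x y = 0 := by rw [sub_mul, h2, sub_self]
  refine (mul_eq_zero.1 h3).resolve_left fun h4 => hne ?_
  exact (RingHom.injective (starRingEnd ℂ) (sub_eq_zero.1 h4)).symm

/-- If (T - z)²x = 0, then y = (T - z)x is killed by T - z, hence by (T - z)*, and ‖y‖² = ⟨x, (T -
z)*y⟩ = 0. -/
lemma kernel_shift_eq (h : IsNormalPlusNilpotent T P) {z : ℂ} (hz : z ≠ 0) :
    kernel (shift T z) = kernel (shift T z ^ 2) := by
  ext x
  simp only [mem_kernel_iff, sq, mul_apply_eq_comp]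
  refine ⟨fun hx => by rw [hx, map_zero], fun hx => ?_⟩
  have h1 := h.shift_adjoint_eq_zero hz hx
  have h2 : ContinuousLinearMap.adjoint (shift T z) (shift T z x) = 0 := by
    rw [← h1]
    unfold shift
    rw [map_sub, map_smulₛₗ, ContinuousLinearMap.adjoint_id]
  have h3 := ContinuousLinearMap.adjoint_inner_right (shift T z) x (shift T z x)
  rw [h2, inner_zero_right, eq_comm, inner_self_eq_zero] at h3
  exact h3

lemma kernel_pow_succ_eq (h : IsNormalPlusNilpotent T P) {k : ℕ} (hk : 1 ≤ k) :
    kernel (T ^ (k + 1)) = kernel (T ^ (k + 2)) := by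
  have hpow (m : ℕ) (x : H) : (T ^ (m + 2)) (P x) = (T ^ (m + 2)) x := by
    rw [pow_add, sq]
    simp only [mul_apply_eq_comp, h.sq_eq]
  have hcomm (m : ℕ) (x : H) : (T ^ m) (P x) = P ((T ^ m) x) := by
    induction m with
    | zero => rfl
    | succ m ih => rw [pow_succ', mul_apply_eq_comp, ih, h.comm]; rfl
  -- For the normal operator N = TP, the kernels of N² and N coincide.
  have hker (y : H) (hy : T (T (P y)) = 0) : T (P y) = 0 := by
    have h1 := h.norm_shift_adjoint_proj 0 (T (P y))
    have h0 : P (T (P y)) = T (P y) := by rw [← h.comm, h.idem]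
    rw [shift_apply, shift_apply, h0, hy] at h1
    simp only [map_zero, zero_smul, sub_zero, norm_zero, norm_eq_zero] at h1
    have h3 := ContinuousLinearMap.adjoint_inner_right T (P y) (T (P y))
    rw [h1, inner_zero_right, eq_comm, inner_self_eq_zero] at h3
    exact h3
  -- With k = l + 1 both exponents are at least 2, so the square-zero part has already disappeared.
  obtain ⟨l, rfl⟩ := Nat.exists_eq_add_of_le' hk
  ext x
  simp only [mem_kernel_iff]
  refine ⟨fun hx => by rw [pow_succ', mul_apply_eq_comp, hx, map_zero], fun hx => ?_⟩
  rw [← hpow, pow_succ', mul_apply_eq_comp, hcomm] at hx ⊢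
  rw [pow_succ', mul_apply_eq_comp, ← h.comm] at hx
  exact hker _ hx

/-- The vectors f(y) and f(z) are orthogonal for y ≠ z; letting y → z gives ‖f(z)‖² = 0. Of
analyticity only continuity matters. -/
lemma hasSVEP (h : IsNormalPlusNilpotent T P) : HasSVEP T := by
  intro z₀ U hU _ f hf hker z hz
  have hcont : Tendsto f (𝓝[≠] z) (𝓝 (f z)) :=
    ((hf z hz).continuousAt.tendsto).mono_left nhdsWithin_le_nhds
  have h1 : Tendsto (fun y => inner ℂ (f z) (f y)) (𝓝[≠] z) (𝓝 (inner ℂ (f z) (f z))) :=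
    tendsto_const_nhds.inner hcont
  have h2 : (fun y => inner ℂ (f z) (f y)) =ᶠ[𝓝[≠] z] fun _ => 0 := by
    filter_upwards [self_mem_nhdsWithin, nhdsWithin_le_nhds (hU.mem_nhds hz)] with y hy hyU
    exact h.inner_eq_zero (fun h0 => hy h0.symm) (hker z hz) (hker y hyU)
  exact inner_self_eq_zero.1 (tendsto_nhds_unique (h1.congr' h2) tendsto_const_nhds)

end IsNormalPlusNilpotent

end NormalPlusNilpotent

/-- Under the hypothesis on `α_t`, on the eigenvectors of `T = M_w E M_u` for `z ≠ 0` the operator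
`M_ū E M_w̄` is multiplication by `z̄`, and `T` is the sum of a normal operator and of an operator
with square zero. -/
lemma exists_isNormalPlusNilpotent {X : Type*} {A mX : MeasurableSpace X} {μ : Measure X}
    (hA : A ≤ mX) [SigmaFinite (μ.trim hA)] {u w : X → ℂ}
    (hu : Conditionable A μ u) (hw : Conditionable A μ w) {T : Lp ℂ 2 μ →L[ℂ] Lp ℂ 2 μ}
    (hT : ∀ f : Lp ℂ 2 μ, IsWCE A μ w u f (T f)) {n k : ℕ} (hk : 1 ≤ k)
    (hα : ∀ t : ℝ, 0 < t → ∀ᵐ x ∂μ, 0 ≤ alpha A μ w u n k t x) :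
    ∃ P : Lp ℂ 2 μ →L[ℂ] Lp ℂ 2 μ, IsNormalPlusNilpotent T P ∧
      ∀ z : ℂ, z ≠ 0 → ∀ f : Lp ℂ 2 μ, shift T z f = 0 →
        IsWCE A μ (fun x => conj (u x)) (fun x => conj (w x)) f (conj z • f) := by
  have hC : ‖T‖ₑ ^ 2 ≠ ∞ := by simp
  have hle := condLExp_mul_condLExp_le hA hu hw T hT
  have huw := (conditionable_mul_and_ae_pos hA hu hw hC hle).1
  obtain ⟨hv2, c, hc, huc⟩ := exists_eq_mul_conj hA hu hw hC hle hk hα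
  set s : Set X := {x | condE A μ (fun y => u y * w y) x ≠ 0} with hsdef
  have hs : MeasurableSet[A] s := (measurable_condE A μ _) (measurableSet_singleton 0).compl
  obtain ⟨P, hP⟩ := exists_indicator_clm μ (hA _ hs)
  have hconj : Measurable (conj : ℂ → ℂ) := RCLike.continuous_conj.measurable
  have hv : AEMeasurable (s.indicator w) μ := hw.1.indicator (hA _ hs)
  have hvf (f : Lp ℂ 2 μ) : Conditionable A μ fun x => conj (s.indicator w x) * f x :=
    Conditionable.mul_of_sq (hconj.comp_aemeasurable hv)
      (Lp.memLp f).aestronglyMeasurable.aemeasurable (by simpa using hv2)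
      (condLExp_sq_lt_top_of_memLp hA (Lp.memLp f))
  have hN (f : Lp ℂ 2 μ) : ∀ᵐ x ∂μ, (T ∘L P) f x =
      c x * s.indicator w x * condE A μ (fun x => conj (s.indicator w x) * f x) x :=
    ae_eq_of_eq_mul_conj hA hT hs hP hc huc (hvf f)
  have h : IsNormalPlusNilpotent T P :=
    ⟨comm_indicator_clm hA hT hs hP, indicator_clm_idem hP, indicator_clm_adjoint hP,
      sq_indicator_clm hA hT huw hP, isStarNormal_of_ae_eq hA hc hv hvf hN⟩
  refine ⟨P, h, fun z hz f hf => ?_⟩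
  have hPf := h.proj_eq_self hz hf
  have hfs : ∀ᵐ x ∂μ, f x = s.indicator f x := by
    have := hP f
    rwa [hPf] at this
  have hwv : (fun x => conj (s.indicator w x) * f x) =ᵐ[μ] fun x => conj (w x) * f x := by
    filter_upwards [hfs] with x hx
    by_cases hxs : x ∈ s
    · simp [hxs]
    · rw [hx]; simp [hxs]
  -- As Pf = f, the eigenvalue equation for T* is one for (TP)*, which has an explicit formula.
  have hadj : conj z • f = ContinuousLinearMap.adjoint (T ∘L P) f := by
    have := h.shift_adjoint_eq_zero hz hf
    rw [shift_apply, sub_eq_zero] at this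
    rw [h.adjoint_comp_apply, hPf, this]
  have hoff : (fun x => conj (s.indicator w x) * f x) =
      s.indicator fun x => conj (s.indicator w x) * f x :=
    funext fun x => by by_cases hx : x ∈ s <;> simp [hx]
  have hoffE := condE_indicator hA hs (hvf f).1
  rw [← hoff] at hoffE
  refine ⟨(hvf f).congr hwv, ?_⟩
  rw [hadj]
  filter_upwards [adjoint_ae_eq hA hc hv hvf hN f, condE_congr (A := A) hwv, hoffE, huc]
    with x h1 h2 h3 h4
  rw [h1, ← h2]
  -- On s, c̄w = ū turns the adjoint formula into ūE(w̄f). Off s the factor v vanishes on one side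
  -- and E(w̄f) on the other, since f is supported in s.
  by_cases hx : x ∈ s
  · rw [h4 hx, Set.indicator_of_mem hx]
    simp
  · rw [h3]
    simp [hx]

end WeightedCE

theorem corollary3p5 {X : Type*} {mX : MeasurableSpace X} (μ : Measure X)
    (A : MeasurableSpace X) (hA : A ≤ mX) [SigmaFinite μ] [SigmaFinite (μ.trim hA)]
    (u w : X → ℂ)
    (hu : WeightedCE.Conditionable A μ u) (hw : WeightedCE.Conditionable A μ w)
    (T : Lp ℂ 2 μ →L[ℂ] Lp ℂ 2 μ)
    (hT : ∀ f : Lp ℂ 2 μ, WeightedCE.IsWCE A μ w u f (T f))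
    (n k : ℕ) (hk : 1 ≤ k)
    (hα : ∀ t : ℝ, 0 < t → ∀ᵐ x ∂μ, 0 ≤ WeightedCE.alpha A μ w u n k t x) :
    -- (a), for the adjoint of `T` and for the operator `f ↦ ū E(w̄ f)`
    (∀ z : ℂ, z ≠ 0 →
      WeightedCE.kernel (WeightedCE.shift T z) ≤
        WeightedCE.kernel (WeightedCE.shift (ContinuousLinearMap.adjoint T) (conj z)) ∧
      ∀ f ∈ WeightedCE.kernel (WeightedCE.shift T z),
        WeightedCE.IsWCE A μ (fun x => conj (u x)) (fun x => conj (w x)) f (conj z • f)) ∧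
    -- (b)
    (WeightedCE.jointPointSpectrum T \ {0} = WeightedCE.pointSpectrum T \ {0} ∧
      WeightedCE.jointApproxPointSpectrum T \ {0} = WeightedCE.approxPointSpectrum T \ {0}) ∧
    -- (c)
    (∀ z z' : ℂ, z ≠ z' →
      WeightedCE.kernel (WeightedCE.shift T z) ⟂ WeightedCE.kernel (WeightedCE.shift T z')) ∧
    -- (d)
    ((∀ z : ℂ, z ≠ 0 →
        WeightedCE.kernel (WeightedCE.shift T z) = WeightedCE.kernel (WeightedCE.shift T z ^ 2)) ∧
      WeightedCE.kernel (T ^ (k + 1)) = WeightedCE.kernel (T ^ (k + 2))) ∧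
    -- (e)
    WeightedCE.HasSVEP T := by
  obtain ⟨P, h, hwce⟩ := WeightedCE.exists_isNormalPlusNilpotent hA hu hw hT hk hα
  refine ⟨fun z hz => ⟨fun f hf => h.shift_adjoint_eq_zero hz hf, fun f hf => hwce z hz f hf⟩,
    ⟨h.jointPointSpectrum_diff, h.jointApproxPointSpectrum_diff⟩, fun z z' hne => ?_,
    ⟨fun z hz => h.kernel_shift_eq hz, h.kernel_pow_succ_eq hk⟩, h.hasSVEP⟩
  exact Submodule.isOrtho_iff_inner_eq.2 fun f hf g hg => h.inner_eq_zero hne hf hg
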